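/- **Setting.** A characteristic string is $w=w_1\dots w_n\in\{0,1\}^n$; slot $t\in\{1,\dots,n\}$ is honest if $w_t=0$ and adversarial if $w_t=1$. A *fork* for $w$, written $F\vdash w$, is a finite rooted tree with edges directed away from the root and a labeling of its vertices by $\{0,1,\dots,n\}$ such that (i) the root has label $0$; (ii) labels strictly increase along directed paths; (iii) each honest slot is the label of exactly one vertex; (iv) if $i<j$ are honest slots, the vertex labeled $i$ has strictly smaller depth than the vertex labeled $j$. Write $F\sqsubseteq F'$ if $F$ appears in $F'$ as a consistently labeled subgraph (with the same root). A *tine* is a directed path starting at the root. *The $(\mathcal D,T;s,k)$-settlement game.* A string $w\in\{0,1\}^T$ is drawn from the distribution $\mathcal D$ and given to the adversary. Let $A_0$ be the fork consisting of the root only. For $t=1,\dots,T$: if $w_t=0$, the challenger forms $F_t$ from $A_{t-1}$ by adding a single vertex labeled $t$ at the end of a longest path of $A_{t-1}$ (the adversary breaks ties); if $w_t=1$, the adversary chooses any fork $F_t\vdash w_1\dots w_t$ with $A_{t-1}\sqsubseteq F_t$; then, in either case, the adversary chooses any fork $A_t\vdash w_1\dots w_t$ with $F_t\sqsubseteq A_t$.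 The adversary wins if for some $t\ge s+k$ the fork $A_t$ contains two tines of maximum length that diverge prior to $s$, i.e. that contain different vertices labeled $s$, or exactly one of which contains a vertex labeled $s$. The *$(s,k)$-settlement insecurity* $\mathbf S^{s,k}[\mathcal D]$ is the maximum, over all adversaries, of the probability of winning this game. A distribution $\mathcal W$ of $W=(W_1,\dots,W_T)\in\{0,1\}^T$ satisfies the *$\epsilon$-martingale condition* if $\Pr[W_t=1\mid W_1,\dots,W_{t-1}]\le(1-\epsilon)/2$ for every $t\in\{1,\dots,T\}$ and all values of $W_1,\dots,W_{t-1}$. Let $\mathcal B_\epsilon$ be the distribution on $\{0,1\}^T$ of independent bits, each equal to $1$ with probability $(1-\epsilon)/2$. **Theorem.** There is an absolute constant $c>0$ such that for all $\epsilon\in(0,1)$, all $s,k,T\in\mathbb N$ and every distribution $\mathcal W$ on $\{0,1\}^T$ satisfying the $\epsilon$-martingale condition, $$\mathbf S^{s,k}[\mathcal W]\;\le\;\mathbf S^{s,k}[\mathcal B_\epsilon]\;\le\;\exp\bigl(-c\,\epsilon^3\,k\bigr).$$ In particular $\mathbf S^{s,k}[\mathcal B_\epsilon]\le\exp\bigl(-\Omega(\epsilon^3(1-O(\epsilon))k)\bigr)$,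 with constants independent of $\epsilon$, $k$, $s$ and $T$. -/

import Mathlib

/-! ### Labelled rooted trees -/

/-- A finite directed rooted tree with edges directed away from the root, together with a vertex
labelling by slot numbers such that the root has label `0` and labels strictly increase along
directed paths. The tree is given by its parent map; only the root has no parent. As labels
strictly decrease when passing to the parent, every vertex is joined to the root by exactly one
directed path, so this is indeed a tree. -/
structure LabeledTree where
  V : Type
  finite : Finite V
  root : V
  parent : V → Option V
  label : V → ℕ
  parent_eq_none_iff : ∀ v, parent v = none ↔ v = root
  label_root : label root = 0
  label_lt : ∀ u v, parent v = some u → label u < label v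

namespace LabeledTree

/-- The depth of a vertex: the number of edges on the path from the root to it. -/
def depth (F : LabeledTree) (v : F.V) : ℕ :=
  match h : F.parent v with
  | none => 0
  | some u => F.depth u + 1
termination_by F.label v
decreasing_by exact F.label_lt u v h

/-- Tines (directed paths starting at the root) are represented by their terminal vertex.
`F.OnTine x v`: the vertex `x` lies on the tine ending at `v`. -/
def OnTine (F : LabeledTree) (x v : F.V) : Prop :=
  Relation.ReflTransGen (fun a b => F.parent b = some a) x v

/-- The tine ending at `v` has maximum length among all tines of `F`. -/
def IsLongest (F : LabeledTree) (v : F.V) : Prop :=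
  ∀ u, F.depth u ≤ F.depth v

/-- A map of vertices that exhibits `F` as a consistently labelled subgraph of `G`: it is injective
and preserves labels and parents (hence also the root, and every path from the root). -/
structure IsEmbedding (F G : LabeledTree) (φ : F.V → G.V) : Prop where
  injective : Function.Injective φ
  label_eq : ∀ v, G.label (φ v) = F.label v
  parent_eq : ∀ v, G.parent (φ v) = (F.parent v).map φ

/-- `F` appears as a consistently labelled subgraph of `G`. -/
def IsForkPrefix (F G : LabeledTree) : Prop :=
  ∃ φ : F.V → G.V, IsEmbedding F G φ

/-- `G` arises from `F` by adding a single vertex, labelled `t`, to the end of a longest path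
of `F`. -/
def IsHonestExtension (t : ℕ) (F G : LabeledTree) : Prop :=
  ∃ (φ : F.V → G.V) (u : F.V) (v : G.V), IsEmbedding F G φ ∧ F.IsLongest u ∧
    v ∉ Set.range φ ∧ (∀ x, x = v ∨ x ∈ Set.range φ) ∧
    G.label v = t ∧ G.parent v = some (φ u)

/-! ### Characteristic strings and forks

A characteristic string is a list of Booleans; `true` stands for the symbol `1` (adversarial slot)
and `false` for the symbol `0` (slot with a unique honest leader). Slots are numbered from `1`. -/

/-- Slot `i` is honest for the string `w`, i.e. `1 ≤ i ≤ |w|` and `w_i = 0`. -/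
def HonestSlot (w : List Bool) (i : ℕ) : Prop :=
  ∃ j, i = j + 1 ∧ w[j]? = some false

/-- `F ⊢ w`: `F` is a fork for the characteristic string `w`. -/
structure IsFork (F : LabeledTree) (w : List Bool) : Prop where
  label_le : ∀ v, F.label v ≤ w.length
  unique_honest : ∀ i, HonestSlot w i → ∃! v, F.label v = i
  honest_depth : ∀ u v, HonestSlot w (F.label u) → HonestSlot w (F.label v) →
    F.label u < F.label v → F.depth u < F.depth v

/-- The tines ending at `u` and `v` diverge prior to slot `s`: they contain different vertices
labelled `s`, or one of them contains a vertex labelled `s` while the other does not. -/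
def DivergePriorTo (F : LabeledTree) (s : ℕ) (u v : F.V) : Prop :=
  (∃ x y, F.OnTine x u ∧ F.OnTine y v ∧ F.label x = s ∧ F.label y = s ∧ x ≠ y) ∨
  ((∃ x, F.OnTine x u ∧ F.label x = s) ∧ ¬ ∃ y, F.OnTine y v ∧ F.label y = s) ∨
  ((¬ ∃ x, F.OnTine x u ∧ F.label x = s) ∧ ∃ y, F.OnTine y v ∧ F.label y = s)

/-- `F` contains two tines of maximum length that diverge prior to slot `s`. -/
def HasSettlementViolation (F : LabeledTree) (s : ℕ) : Prop :=
  ∃ u v, F.IsLongest u ∧ F.IsLongest v ∧ F.DivergePriorTo s u v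

end LabeledTree

/-! ### The settlement game -/

/-- The prefix `w_1 … w_t` of a string `w ∈ {0,1}^T`. -/
def stringPrefix {T : ℕ} (w : Fin T → Bool) (t : ℕ) : List Bool :=
  (List.ofFn w).take t

/-- A play of the settlement game on the characteristic string `w ∈ {0,1}^T`, following the rules.
The fork after the adversarial augmentation in slot `t` is `A t`, for `t = 0, …, T`. The slot with
number `t + 1` has symbol `w t`; the fork `F t` is the one determined in this slot, by the
challenger if `w t = 0` and by the adversary if `w t = 1`, before the augmentation. -/
structure SettlementPlay {T : ℕ} (w : Fin T → Bool) where
  A : Fin (T + 1) → LabeledTree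
  F : Fin T → LabeledTree
  /-- The initial fork consists of the genesis vertex only. -/
  initial : ∀ v, v = (A 0).root
  /-- In an honest slot the challenger extends a longest path (the adversary breaks ties). -/
  honest : ∀ t : Fin T, w t = false →
    LabeledTree.IsHonestExtension ((t : ℕ) + 1) (A t.castSucc) (F t)
  /-- In an adversarial slot the adversary chooses any fork extending the current one. -/
  adversarial : ∀ t : Fin T, w t = true →
    (F t).IsFork (stringPrefix w ((t : ℕ) + 1)) ∧ LabeledTree.IsForkPrefix (A t.castSucc) (F t)
  /-- Adversarial augmentation. -/
  augment : ∀ t : Fin T,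
    (A t.succ).IsFork (stringPrefix w ((t : ℕ) + 1)) ∧ LabeledTree.IsForkPrefix (F t) (A t.succ)

/-- The adversary wins with parameters `s, k` if slot `s` is not `k`-settled in some fork `A t` with
`t ≥ s + k`. -/
def SettlementPlay.Wins {T : ℕ} {w : Fin T → Bool} (P : SettlementPlay w) (s k : ℕ) : Prop :=
  ∃ t : Fin (T + 1), s + k ≤ (t : ℕ) ∧ (P.A t).HasSettlementViolation s

/-- An adversary. As the whole characteristic string is given to the adversary at the start and
the challenger is deterministic up to ties, which the adversary breaks, an adversary amounts to a
choice of a play for each characteristic string. -/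
def Adversary (T : ℕ) : Type 1 :=
  ∀ w : Fin T → Bool, SettlementPlay w

/-- The `(s,k)`-settlement insecurity of a distribution `D` on `{0,1}^T`: the largest probability,
over all adversaries, of winning the settlement game. -/
noncomputable def settlementInsecurity {T : ℕ} (D : MeasureTheory.Measure (Fin T → Bool))
    (s k : ℕ) : ENNReal :=
  ⨆ 𝒜 : Adversary T, D {w | (𝒜 w).Wins s k}

/-! ### Distributions of characteristic strings -/

/-- The `ε`-martingale condition: for every slot `t`, the conditional probability of `W_t = 1`, given
any values of the previous symbols (that occur with positive probability), is at most
`(1 - ε) / 2`. (Conditioning on a null event yields the zero measure and so imposes nothing.) -/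
def EpsMartingale (ε : ℝ) {T : ℕ} (W : MeasureTheory.Measure (Fin T → Bool)) : Prop :=
  ∀ (t : Fin T) (a : Fin T → Bool),
    (ProbabilityTheory.cond W {w | ∀ i < t, w i = a i}) {w | w t = true} ≤
      ENNReal.ofReal ((1 - ε) / 2)

/-- The distribution on `{0,1}^T` of independent symbols, each equal to `1` with probability
`(1 - ε) / 2`. -/
noncomputable def iidBernoulli (ε : ℝ) (hε : ε ∈ Set.Ioo (0 : ℝ) 1) (T : ℕ) :
    MeasureTheory.Measure (Fin T → Bool) :=
  MeasureTheory.Measure.pi fun _ =>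
    ProbabilityTheory.bernoulliMeasure true false
      ⟨(1 - ε) / 2, by constructor <;> linarith [hε.1, hε.2]⟩

/-!
An honest slot is a *Catalan slot* if every interval of slots containing it has a strict honest
majority. In every fork, every tine of maximum length passes through the unique vertex of a Catalan
slot (`LabeledTree.exists_onTine_of_catalan`): honest vertices have increasing depths, so a tine
that avoids the slot would have to bridge some interval around it with adversarial vertices, of
which there are too few. Two longest tines that share this vertex agree on all earlier slots. Hence
the adversary can only win if none of the slots `s, …, s + k` is a Catalan slot of the string, and
this reduces the second inequality to a question about a random walk.

For the walk, take a window of `n` slots and scan it, remembering the deficit `d` of the walk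
against its running maximum and the number `m` of excess adversarial symbols that destroy the
earliest surviving Catalan candidate. Weighting a state by `γ ^ d * σ ^ m`, with `γ = 1 + ε ^ 2 / 8`
and with `σ` slightly above the gambler's ruin probability `(1 - ε) / (1 + ε)`, gives an expectation
that contracts by `1 - θ`, `θ = ε ^ 3 / 16`, in every slot, and the final weight dominates the
probability that the symbols after the window destroy the candidate. As the deficit before the
window is dominated by a geometric law, a window of `n` slots has no Catalan slot with probability
at most `2 * (1 - θ) ^ n` (`one_sub_catalanProb_le`). The factor `2` matters for short windows. It
is removed by a union bound (`catalanProb_mul_le`): `m` consecutive windows of length `n` contain a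
Catalan slot with at most `m` times the probability for one of them, so a short window inherits its
share of the success probability of a window of length about `2 / θ`.

For the first inequality, the insecurity is the probability of the set of strings on which the
adversary can win (`settlementInsecurity_eq`). This set is increasing, since a play remains legal
when honest slots become adversarial (`SettlementPlay.mono`), and among the distributions with the
`ε`-martingale condition the independent one maximizes the probability of increasing events
(`measureReal_le_pi_bernoulli`).
-/

/-! ### Expectations over independent coin flips -/

/-- The expectation of `f` on a random string of length `n` with independent symbols, each equal
to `true` with probability `p`. -/
noncomputable def coinExp (p : ℝ) : ℕ → (List Bool → ℝ) → ℝ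
  | 0, f => f []
  | n + 1, f => (1 - p) * coinExp p n (fun l => f (false :: l)) +
      p * coinExp p n (fun l => f (true :: l))

open Classical in
/-- The probability of `Q` for a random string of length `n` with independent symbols, each equal
to `true` with probability `p`. -/
noncomputable def coinProb (p : ℝ) (n : ℕ) (Q : List Bool → Prop) : ℝ :=
  coinExp p n fun l => if Q l then 1 else 0

theorem coinExp_congr {p : ℝ} {n : ℕ} {f g : List Bool → ℝ}
    (h : ∀ l, l.length = n → f l = g l) : coinExp p n f = coinExp p n g := by
  induction n generalizing f g with
  | zero => exact h [] rfl
  | succ n ih =>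
    simp only [coinExp]
    rw [ih fun l hl => h (false :: l) (by simp [hl]), ih fun l hl => h (true :: l) (by simp [hl])]

theorem coinExp_mono {p : ℝ} (h0 : 0 ≤ p) (h1 : p ≤ 1) {n : ℕ} {f g : List Bool → ℝ}
    (h : ∀ l, l.length = n → f l ≤ g l) : coinExp p n f ≤ coinExp p n g := by
  induction n generalizing f g with
  | zero => exact h [] rfl
  | succ n ih =>
    simp only [coinExp]
    have hp : 0 ≤ 1 - p := by linarith
    gcongr
    · exact ih fun l hl => h (false :: l) (by simp [hl])
    · exact ih fun l hl => h (true :: l) (by simp [hl])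

@[simp]
theorem coinExp_const (p : ℝ) (n : ℕ) (c : ℝ) : coinExp p n (fun _ => c) = c := by
  induction n with
  | zero => rfl
  | succ n ih => simp only [coinExp, ih]; ring

theorem coinExp_add (p : ℝ) (n : ℕ) (f g : List Bool → ℝ) :
    coinExp p n (fun l => f l + g l) = coinExp p n f + coinExp p n g := by
  induction n generalizing f g with
  | zero => rfl
  | succ n ih => simp only [coinExp, ih]; ring

theorem coinExp_const_mul (p : ℝ) (n : ℕ) (c : ℝ) (f : List Bool → ℝ) :
    coinExp p n (fun l => c * f l) = c * coinExp p n f := by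
  induction n generalizing f with
  | zero => rfl
  | succ n ih => simp only [coinExp, ih]; ring

theorem coinExp_sum (p : ℝ) (n : ℕ) {ι : Type*} (s : Finset ι) (f : ι → List Bool → ℝ) :
    coinExp p n (fun l => ∑ i ∈ s, f i l) = ∑ i ∈ s, coinExp p n (f i) := by
  induction n generalizing f with
  | zero => rfl
  | succ n ih => simp only [coinExp, ih, Finset.sum_add_distrib, Finset.mul_sum]

/-- Fubini: a string of length `m + n` is an independent pair of strings of lengths `m`, `n`. -/
theorem coinExp_append (p : ℝ) (m n : ℕ) (f : List Bool → ℝ) :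
    coinExp p (m + n) f = coinExp p m fun u => coinExp p n fun v => f (u ++ v) := by
  induction m generalizing f with
  | zero => simp [coinExp]
  | succ m ih => rw [Nat.succ_add]; simp only [coinExp, ih, List.cons_append]

theorem coinExp_snoc (p : ℝ) (n : ℕ) (f : List Bool → ℝ) :
    coinExp p (n + 1) f =
      coinExp p n fun u => (1 - p) * f (u ++ [false]) + p * f (u ++ [true]) := by
  rw [coinExp_append]; rfl

theorem coinExp_append_take (p : ℝ) (m n : ℕ) (f : List Bool → ℝ) :
    (coinExp p m fun u => coinExp p n fun v => f ((u ++ v).take n)) = coinExp p n f := by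
  rw [← coinExp_append p m n fun l => f (l.take n), add_comm, coinExp_append]
  refine coinExp_congr fun l hl => ?_
  simp [← hl]

theorem coinExp_append_drop (p : ℝ) (m n : ℕ) (f : List Bool → ℝ) :
    (coinExp p m fun u => coinExp p n fun v => f ((u ++ v).drop n)) = coinExp p m f := by
  rw [← coinExp_append p m n fun l => f (l.drop n), add_comm, coinExp_append]
  rw [coinExp_congr (g := fun _ => coinExp p m f), coinExp_const]
  intro l hl
  simp [← hl]

theorem coinProb_le_one {p : ℝ} (h0 : 0 ≤ p) (h1 : p ≤ 1) (n : ℕ) (Q : List Bool → Prop) :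
    coinProb p n Q ≤ 1 := by
  rw [← coinExp_const p n 1]
  exact coinExp_mono h0 h1 fun l _ => by split_ifs <;> norm_num

theorem coinProb_mono {p : ℝ} (h0 : 0 ≤ p) (h1 : p ≤ 1) {n : ℕ} {Q R : List Bool → Prop}
    (h : ∀ l, l.length = n → Q l → R l) : coinProb p n Q ≤ coinProb p n R := by
  refine coinExp_mono h0 h1 fun l hl => ?_
  by_cases hQ : Q l
  · simp [hQ, h l hl hQ]
  · simp only [hQ, if_false]; split_ifs <;> norm_num

theorem coinProb_not (p : ℝ) (n : ℕ) (Q : List Bool → Prop) :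
    coinProb p n (fun l => ¬ Q l) = 1 - coinProb p n Q := by
  have h : coinProb p n (fun l => ¬ Q l) + coinProb p n Q = 1 := by
    rw [coinProb, coinProb, ← coinExp_add, ← coinExp_const p n 1]
    refine coinExp_congr fun l _ => ?_
    by_cases hQ : Q l <;> simp [hQ]
  linarith

/-! ### Catalan slots -/

/-- The number of honest symbols minus the number of adversarial symbols. -/
def balance (l : List Bool) : ℤ := (l.count false : ℤ) - l.count true

@[simp] theorem balance_nil : balance [] = 0 := rfl

@[simp] theorem balance_append (u v : List Bool) : balance (u ++ v) = balance u + balance v := by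
  simp only [balance, List.count_append]; push_cast; ring

@[simp] theorem balance_cons_false (l : List Bool) : balance (false :: l) = balance l + 1 := by
  simp only [balance, List.count_cons]; simp; ring

@[simp] theorem balance_cons_true (l : List Bool) : balance (true :: l) = balance l - 1 := by
  simp only [balance, List.count_cons]; simp; ring

/-- Every suffix of `u` has at least as many honest as adversarial symbols. -/
def SuffixesNonneg (u : List Bool) : Prop := ∀ a b, u = a ++ b → 0 ≤ balance b

/-- Every prefix of `v` has at least as many honest as adversarial symbols. -/
def PrefixesNonneg (v : List Bool) : Prop := ∀ a b, v = a ++ b → 0 ≤ balance a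

theorem SuffixesNonneg.of_append {a u : List Bool} (h : SuffixesNonneg (a ++ u)) :
    SuffixesNonneg u := fun c b hu => h (a ++ c) b (by simp [hu])

theorem PrefixesNonneg.of_append {v b : List Bool} (h : PrefixesNonneg (v ++ b)) :
    PrefixesNonneg v := fun a c hv => h a (c ++ b) (by simp [hv])

/-- In the string `x ++ y ++ z`, some slot of the window `y` is a Catalan slot: an honest slot such
that every interval of slots containing it has a strict honest majority. Equivalently, all suffixes
of what precedes the slot and all prefixes of what follows it have nonnegative balance. -/
def HasCatalan (x y z : List Bool) : Prop :=
  ∃ y₁ y₂, y = y₁ ++ false :: y₂ ∧ SuffixesNonneg (x ++ y₁) ∧ PrefixesNonneg (y₂ ++ z)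

theorem HasCatalan.drop {x y z : List Bool} (h : HasCatalan x y z) (n : ℕ) :
    HasCatalan (x.drop n) y z := by
  obtain ⟨y₁, y₂, hy, h₁, h₂⟩ := h
  refine ⟨y₁, y₂, hy, ?_, h₂⟩
  rw [← List.take_append_drop n x, List.append_assoc] at h₁
  exact h₁.of_append

theorem HasCatalan.take {x y z : List Bool} (h : HasCatalan x y z) (n : ℕ) :
    HasCatalan x y (z.take n) := by
  obtain ⟨y₁, y₂, hy, h₁, h₂⟩ := h
  refine ⟨y₁, y₂, hy, h₁, ?_⟩
  rw [← List.take_append_drop n z, ← List.append_assoc] at h₂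
  exact h₂.of_append

theorem HasCatalan.of_append {x y y' z : List Bool} (h : HasCatalan x (y ++ y') z) :
    HasCatalan x y (y' ++ z) ∨ HasCatalan (x ++ y) y' z := by
  obtain ⟨y₁, y₂, hy, h₁, h₂⟩ := h
  rw [List.append_eq_append_iff] at hy
  obtain ⟨a, rfl, rfl⟩ | ⟨c, rfl, hc⟩ := hy
  · exact .inr ⟨a, y₂, rfl, by simpa using h₁, h₂⟩
  · cases c with
    | nil =>
      simp only [List.nil_append] at hc
      exact .inr ⟨[], y₂, hc.symm, by simpa using h₁, h₂⟩
    | cons b c =>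
      simp only [List.cons_append, List.cons.injEq] at hc
      obtain ⟨rfl, rfl⟩ := hc
      exact .inl ⟨y₁, c, rfl, h₁, by simpa using h₂⟩

/-- The probability that a window of `n` slots, with `L` slots before and `R` slots after it,
contains a Catalan slot. -/
noncomputable def catalanProb (p : ℝ) (L n R : ℕ) : ℝ :=
  coinExp p L fun x => coinExp p n fun y => coinProb p R fun z => HasCatalan x y z

/-- The union bound: cut the long window in two, and discard the symbols beyond the `L` preceding
and the `R` following each part, which only makes Catalan slots more likely. -/
theorem catalanProb_add_le {p : ℝ} (h0 : 0 ≤ p) (h1 : p ≤ 1) (L n N R : ℕ) :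
    catalanProb p L (n + N) R ≤ catalanProb p L n R + catalanProb p L N R := by
  classical
  have e₁ : catalanProb p L n R = coinExp p L fun x => coinExp p n fun y => coinExp p N fun y' =>
      coinExp p R fun z => if HasCatalan x y ((y' ++ z).take R) then 1 else 0 := by
    refine coinExp_congr fun x _ => coinExp_congr fun y _ => ?_
    exact (coinExp_append_take p N R fun z => if HasCatalan x y z then 1 else 0).symm
  have e₂ : catalanProb p L N R = coinExp p L fun x => coinExp p n fun y => coinExp p N fun y' =>
      coinExp p R fun z => if HasCatalan ((x ++ y).drop n) y' z then 1 else 0 := by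
    exact (coinExp_append_drop p L n fun x => coinExp p N fun y' =>
      coinExp p R fun z => if HasCatalan x y' z then 1 else 0).symm
  rw [e₁, e₂, ← coinExp_add, catalanProb]
  refine coinExp_mono h0 h1 fun x _ => ?_
  rw [← coinExp_add, coinExp_append]
  refine coinExp_mono h0 h1 fun y _ => ?_
  rw [← coinExp_add]
  refine coinExp_mono h0 h1 fun y' _ => ?_
  rw [← coinExp_add]
  refine coinExp_mono h0 h1 fun z _ => ?_
  by_cases h : HasCatalan x (y ++ y') z
  · rcases h.of_append with h' | h'
    · rw [if_pos h, if_pos (h'.take R)]; split_ifs <;> norm_num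
    · rw [if_pos h, if_pos (h'.drop n)]; split_ifs <;> norm_num
  · rw [if_neg h]; split_ifs <;> norm_num

theorem catalanProb_zero (p : ℝ) (L R : ℕ) : catalanProb p L 0 R = 0 := by
  simp [catalanProb, coinExp, HasCatalan, coinProb]

theorem catalanProb_mul_le {p : ℝ} (h0 : 0 ≤ p) (h1 : p ≤ 1) (L n R m : ℕ) :
    catalanProb p L (m * n) R ≤ m * catalanProb p L n R := by
  induction m with
  | zero => simp [catalanProb_zero]
  | succ m ih =>
    rw [Nat.succ_mul]
    refine (catalanProb_add_le h0 h1 L (m * n) n R).trans ?_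
    push_cast; linarith

/-! ### The walk below its running maximum -/

/-- The deficit of a string: how far the walk with an up-step for every honest and a down-step for
every adversarial symbol ends below its running maximum. -/
def deficit (x : List Bool) : ℕ := x.foldl (fun d b => if b then d + 1 else d - 1) 0

@[simp] theorem deficit_nil : deficit [] = 0 := rfl

@[simp] theorem deficit_snoc_true (x : List Bool) : deficit (x ++ [true]) = deficit x + 1 := by
  simp [deficit]

@[simp] theorem deficit_snoc_false (x : List Bool) : deficit (x ++ [false]) = deficit x - 1 := by
  simp [deficit]

theorem neg_balance_le_deficit (x : List Bool) :
    ∀ a b, x = a ++ b → -balance b ≤ deficit x := by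
  induction x using List.reverseRecOn with
  | nil => intro a b h; simp_all
  | append_singleton x c ih =>
    intro a b h
    rcases List.eq_nil_or_concat' b with rfl | ⟨b', c', rfl⟩
    · simp
    · rw [← List.append_assoc] at h
      obtain ⟨hx, hc⟩ := List.append_inj' h rfl
      obtain rfl : c = c' := by simpa using hc
      have := ih a b' hx
      cases c <;> simp <;> omega

theorem suffixesNonneg_of_deficit_eq_zero {x : List Bool} (h : deficit x = 0) :
    SuffixesNonneg x := fun a b hx => by
  have := neg_balance_le_deficit x a b hx
  rw [h] at this; simpa using this

theorem deficit_le_length (x : List Bool) : deficit x ≤ x.length := by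
  induction x using List.reverseRecOn with
  | nil => simp
  | append_singleton x c ih => cases c <;> simp <;> omega

/-- One slot of the pair `(d, m)`, where `d` is the deficit and `m` measures the first surviving
Catalan candidate: `m - 1` is the balance of the symbols after it, so that an excess of `m`
adversarial symbols destroys it, and `m = 0` if there is no candidate. A candidate appears when an
honest symbol comes at deficit `0`. -/
def candidateStep (s : ℕ × ℕ) (b : Bool) : ℕ × ℕ :=
  if b then (s.1 + 1, s.2 - 1) else (s.1 - 1, if s.1 = 0 ∨ s.2 ≠ 0 then s.2 + 1 else 0)

/-- The deficit and the measure of the first surviving candidate (see `candidateStep`) at the end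
of the window `y`, when `x` precedes it. -/
def candidateState (x y : List Bool) : ℕ × ℕ := y.foldl candidateStep (deficit x, 0)

theorem candidateState_snoc (x y : List Bool) (b : Bool) :
    candidateState x (y ++ [b]) = candidateStep (candidateState x y) b := by
  simp [candidateState]

theorem candidateState_spec (x y : List Bool) :
    (candidateState x y).1 = deficit (x ++ y) ∧
      ((candidateState x y).2 ≠ 0 → ∃ y₁ y₂, y = y₁ ++ false :: y₂ ∧ SuffixesNonneg (x ++ y₁) ∧
        PrefixesNonneg y₂ ∧ balance y₂ + 1 = (candidateState x y).2) := by
  have prefixes_snoc : ∀ (l : List Bool) (b : Bool), PrefixesNonneg l → 0 ≤ balance (l ++ [b]) →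
      PrefixesNonneg (l ++ [b]) := by
    intro l b hl hb a c h
    rcases List.eq_nil_or_concat' c with rfl | ⟨c', b', rfl⟩
    · rw [List.append_nil] at h
      rwa [← h]
    · rw [← List.append_assoc] at h
      exact hl a c' (List.append_inj' h rfl).1
  induction y using List.reverseRecOn with
  | nil => simp [candidateState]
  | append_singleton y b ih =>
    obtain ⟨ih₁, ih₂⟩ := ih
    rw [candidateState_snoc]
    generalize candidateState x y = s at ih₁ ih₂ ⊢
    obtain ⟨d, m⟩ := s
    simp only at ih₁ ih₂
    subst ih₁
    rw [← List.append_assoc]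
    cases b with
    | true =>
      refine ⟨by simp [candidateStep, -List.append_assoc], fun hm => ?_⟩
      simp only [candidateStep, if_true] at hm ⊢
      obtain ⟨y₁, y₂, rfl, h₁, h₂, h₃⟩ := ih₂ (by omega)
      refine ⟨y₁, y₂ ++ [true], by simp, h₁, prefixes_snoc _ _ h₂ ?_, ?_⟩ <;> simp <;> omega
    | false =>
      refine ⟨by simp [candidateStep, -List.append_assoc], fun hm => ?_⟩
      simp only [candidateStep] at hm ⊢
      by_cases h0 : m = 0
      · subst h0
        have hd : deficit (x ++ y) = 0 := by by_contra hd; simp [hd] at hm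
        refine ⟨y, [], by simp, suffixesNonneg_of_deficit_eq_zero hd, ?_, by simp [hd]⟩
        intro a c h
        simp_all
      · obtain ⟨y₁, y₂, rfl, h₁, h₂, h₃⟩ := ih₂ h0
        refine ⟨y₁, y₂ ++ [false], by simp, h₁, prefixes_snoc _ _ h₂ ?_, ?_⟩
        · simp; omega
        · simp [h0]; omega

/-- Without a Catalan slot in the window, the symbols after the window destroy the candidate. -/
theorem exists_prefix_of_not_hasCatalan {x y z : List Bool} (h : ¬ HasCatalan x y z) :
    ∃ a b, z = a ++ b ∧ balance a + (candidateState x y).2 ≤ 0 := by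
  by_cases hm : (candidateState x y).2 = 0
  · exact ⟨[], z, rfl, by simp [hm]⟩
  obtain ⟨y₁, y₂, hy, h₁, h₂, h₃⟩ := (candidateState_spec x y).2 hm
  by_contra! hz
  refine h ⟨y₁, y₂, hy, h₁, fun a b hab => ?_⟩
  rw [List.append_eq_append_iff] at hab
  obtain ⟨c, rfl, rfl⟩ | ⟨c, rfl, -⟩ := hab
  · have := hz c b rfl
    simp; omega
  · exact h₂ a c rfl

/-! ### Exponential tail for windows without Catalan slots -/

/-- Powers of `p / (1 - p)` are harmonic for the biased walk. -/
theorem pow_harmonic {p : ℝ} (h1 : p < 1) (m : ℕ) :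
    (1 - p) * (p / (1 - p)) ^ (m + 2) + p * (p / (1 - p)) ^ m = (p / (1 - p)) ^ (m + 1) := by
  have hq : 0 < 1 - p := by linarith
  have h : (1 - p) * (p / (1 - p)) = p := by field_simp
  calc _ = ((1 - p) * (p / (1 - p))) * (p / (1 - p)) ^ (m + 1) + p * (p / (1 - p)) ^ m := by ring
    _ = p * (p / (1 - p)) ^ (m + 1) + (1 - p) * (p / (1 - p)) * (p / (1 - p)) ^ m := by rw [h]
    _ = _ := by ring

/-- The gambler's ruin bound: a further `m` excess adversarial symbols ever occur with probability
at most `(p / (1 - p)) ^ m`. -/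
theorem coinProb_exists_prefix_le {p : ℝ} (h0 : 0 ≤ p) (h1 : p < 1) (n m : ℕ) :
    coinProb p n (fun z => ∃ a b, z = a ++ b ∧ balance a + m ≤ 0) ≤ (p / (1 - p)) ^ m := by
  have hq : 0 < 1 - p := by linarith
  have hβ : 0 ≤ p / (1 - p) := by positivity
  induction n generalizing m with
  | zero =>
    cases m with
    | zero => simpa using coinProb_le_one h0 h1.le 0 _
    | succ m =>
      simp only [coinProb, coinExp]
      rw [if_neg]
      · positivity
      · rintro ⟨a, b, hab, h⟩
        obtain ⟨rfl, rfl⟩ := List.append_eq_nil_iff.1 hab.symm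
        simp at h; omega
  | succ n ih =>
    cases m with
    | zero => simpa using coinProb_le_one h0 h1.le (n + 1) _
    | succ m =>
      have hf : coinProb p n (fun z => ∃ a b, false :: z = a ++ b ∧ balance a + (m + 1 : ℕ) ≤ 0) ≤
          (p / (1 - p)) ^ (m + 2) := by
        refine (coinProb_mono h0 h1.le fun z _ => ?_).trans (ih (m + 2))
        rintro ⟨a, b, hz, h⟩
        rcases a with - | ⟨c, a⟩
        · simp at h; omega
        · simp only [List.cons_append, List.cons.injEq] at hz
          obtain ⟨rfl, rfl⟩ := hz
          refine ⟨a, b, rfl, ?_⟩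
          simp at h; push_cast; omega
      have ht : coinProb p n (fun z => ∃ a b, true :: z = a ++ b ∧ balance a + (m + 1 : ℕ) ≤ 0) ≤
          (p / (1 - p)) ^ m := by
        refine (coinProb_mono h0 h1.le fun z _ => ?_).trans (ih m)
        rintro ⟨a, b, hz, h⟩
        rcases a with - | ⟨c, a⟩
        · simp at h; omega
        · simp only [List.cons_append, List.cons.injEq] at hz
          obtain ⟨rfl, rfl⟩ := hz
          refine ⟨a, b, rfl, ?_⟩
          simp at h; omega
      rw [← pow_harmonic h1 m]
      exact add_le_add (mul_le_mul_of_nonneg_left hf hq.le) (mul_le_mul_of_nonneg_left ht h0)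

/-- The deficit is stochastically dominated by the geometric law, which is stationary for it. -/
theorem coinProb_le_deficit_le {p : ℝ} (h0 : 0 ≤ p) (h1 : p < 1) (n j : ℕ) :
    coinProb p n (fun x => j ≤ deficit x) ≤ (p / (1 - p)) ^ j := by
  have hq : 0 < 1 - p := by linarith
  have hβ : 0 ≤ p / (1 - p) := by positivity
  induction n generalizing j with
  | zero =>
    cases j with
    | zero => simp [coinProb, coinExp]
    | succ j => simp [coinProb, coinExp]; positivity
  | succ n ih =>
    cases j with
    | zero => simpa using coinProb_le_one h0 h1.le (n + 1) _
    | succ j =>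
      rw [coinProb, coinExp_snoc, coinExp_add, coinExp_const_mul, coinExp_const_mul]
      have e₁ : coinProb p n (fun u => j + 1 ≤ deficit (u ++ [false])) ≤
          (p / (1 - p)) ^ (j + 2) := by
        refine (coinProb_mono h0 h1.le fun u _ hu => ?_).trans (ih (j + 2))
        rw [deficit_snoc_false] at hu
        omega
      have e₂ : coinProb p n (fun u => j + 1 ≤ deficit (u ++ [true])) ≤
          (p / (1 - p)) ^ j := by
        refine (coinProb_mono h0 h1.le fun u _ hu => ?_).trans (ih j)
        rw [deficit_snoc_true] at hu
        omega
      rw [← pow_harmonic h1 j]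
      exact add_le_add (mul_le_mul_of_nonneg_left e₁ hq.le) (mul_le_mul_of_nonneg_left e₂ h0)

theorem pow_eq_one_add_sum {γ : ℝ} {d n : ℕ} (h : d ≤ n) :
    γ ^ d = 1 + ∑ j ∈ Finset.range n, (γ - 1) * γ ^ j * (if j + 1 ≤ d then 1 else 0) := by
  induction n with
  | zero => obtain rfl : d = 0 := by omega
            simp
  | succ n ih =>
    rw [Finset.sum_range_succ]
    rcases Nat.lt_or_ge n d with hd | hd
    · obtain rfl : d = n + 1 := by omega
      have : ∀ m : ℕ, γ ^ m = 1 + ∑ j ∈ Finset.range m, (γ - 1) * γ ^ j := by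
        intro m
        rw [← Finset.mul_sum, mul_comm, geom_sum_mul]; ring
      rw [this (n + 1), Finset.sum_range_succ]
      congr 1
      congr 1
      · refine Finset.sum_congr rfl fun j hj => ?_
        rw [if_pos (by have := Finset.mem_range.1 hj; omega), mul_one]
      · simp
    · rw [ih hd, if_neg (by omega)]; simp

/-- Exponential moments of the deficit stay bounded, as `γ` is small compared with the geometric
decay rate of its law. -/
theorem coinExp_pow_deficit_le {p γ : ℝ} (h0 : 0 ≤ p) (h1 : p < 1) (hγ : 1 ≤ γ)
    (hβ : γ * (p / (1 - p)) ≤ 2 - γ) (n : ℕ) :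
    coinExp p n (fun x => γ ^ deficit x) ≤ 2 := by
  classical
  have hq : 0 < 1 - p := by linarith
  set β := p / (1 - p)
  have hβ0 : 0 ≤ β := by positivity
  have e : coinExp p n (fun x => γ ^ deficit x) =
      1 + ∑ j ∈ Finset.range n, (γ - 1) * γ ^ j * coinProb p n (fun x => j + 1 ≤ deficit x) := by
    rw [← coinExp_const p n 1]
    simp only [coinProb, ← coinExp_const_mul]
    rw [← coinExp_sum, ← coinExp_add, coinExp_const]
    refine coinExp_congr fun x hx => ?_
    rw [pow_eq_one_add_sum (hx ▸ deficit_le_length x)]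
    simp
  rw [e]
  have hs : ∑ j ∈ Finset.range n, (γ - 1) * γ ^ j * coinProb p n (fun x => j + 1 ≤ deficit x) ≤
      ∑ j ∈ Finset.range n, (γ - 1) * (γ * β) ^ j := by
    refine Finset.sum_le_sum fun j _ => ?_
    have hβ1 : β ≤ 1 := by nlinarith
    have := (coinProb_le_deficit_le h0 h1 n (j + 1)).trans
      (pow_le_pow_of_le_one hβ0 hβ1 (Nat.le_succ j))
    rw [mul_pow, mul_assoc]
    have : 0 ≤ γ - 1 := by linarith
    gcongr
  have hg : ∑ j ∈ Finset.range n, (γ - 1) * (γ * β) ^ j ≤ 1 := by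
    rw [← Finset.mul_sum]
    have hgeo := geom_sum_mul (γ * β) n
    have hS : 0 ≤ ∑ j ∈ Finset.range n, (γ * β) ^ j := Finset.sum_nonneg fun j _ => by positivity
    have hp : 0 ≤ (γ * β) ^ n := by positivity
    nlinarith
  linarith

/-- Tail bound from a potential: a state with deficit `d` and candidate measure `m` is weighted by
`γ ^ d * σ ^ m`, and the hypotheses say that the expected weight contracts by `1 - θ` in every
slot: `hfree` without a candidate at positive deficit, `hnew` at deficit `0`, where an honest symbol
creates a candidate, and `hcand` with a candidate. -/
theorem one_sub_catalanProb_le {p γ σ θ : ℝ} (h0 : 0 ≤ p) (h1 : p < 1) (hγ : 1 ≤ γ)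
    (hγβ : γ * (p / (1 - p)) ≤ 2 - γ) (hσ : p / (1 - p) ≤ σ) (hσ0 : 0 < σ) (hθ : θ ≤ 1)
    (hfree : (1 - p) / γ + p * γ ≤ 1 - θ) (hnew : (1 - p) * σ + p * γ ≤ 1 - θ)
    (hcand : (1 - p) * σ + p * γ / σ ≤ 1 - θ) (L n R : ℕ) :
    1 - catalanProb p L n R ≤ 2 * (1 - θ) ^ n := by
  classical
  have hγ0 : 0 < γ := by linarith
  have hq : 0 < 1 - p := by linarith
  set Φ : ℕ × ℕ → ℝ := fun s => γ ^ s.1 * σ ^ s.2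
  have contract : ∀ s, (1 - p) * Φ (candidateStep s false) + p * Φ (candidateStep s true) ≤
      (1 - θ) * Φ s := by
    have hcand' : (1 - p) * (σ / γ) + p * γ / σ ≤ 1 - θ := by
      have : σ / γ ≤ σ := div_le_self hσ0.le hγ
      nlinarith
    rintro ⟨_ | d, _ | m⟩
    · simpa [Φ, candidateStep] using hnew
    · have := mul_le_mul_of_nonneg_right hcand (pow_pos hσ0 (m + 1)).le
      refine (le_of_eq ?_).trans (this.trans_eq ?_) <;> simp [Φ, candidateStep]
      field_simp
      ring
    · have := mul_le_mul_of_nonneg_right hfree (pow_pos hγ0 (d + 1)).le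
      refine (le_of_eq ?_).trans (this.trans_eq ?_) <;> simp [Φ, candidateStep]
      field_simp
      ring
    · have := mul_le_mul_of_nonneg_right hcand'
        (mul_pos (pow_pos hγ0 (d + 1)) (pow_pos hσ0 (m + 1))).le
      refine (le_of_eq ?_).trans (this.trans_eq ?_) <;> simp [Φ, candidateStep]
      field_simp
      ring
  have iter : ∀ (x : List Bool) (n : ℕ), coinExp p n (fun y => Φ (candidateState x y)) ≤
      (1 - θ) ^ n * γ ^ deficit x := by
    intro x n
    induction n with
    | zero => simp [coinExp, Φ, candidateState]
    | succ n ih =>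
      simp only [coinExp_snoc, candidateState_snoc]
      refine (coinExp_mono h0 h1.le fun y _ => contract (candidateState x y)).trans ?_
      rw [coinExp_const_mul, pow_succ', mul_assoc]
      exact mul_le_mul_of_nonneg_left ih (by linarith)
  have hz : ∀ x y : List Bool, 1 - coinProb p R (fun z => HasCatalan x y z) ≤
      Φ (candidateState x y) := by
    intro x y
    rw [← coinProb_not]
    refine (coinProb_mono h0 h1.le fun z _ h => exists_prefix_of_not_hasCatalan h).trans ?_
    refine (coinProb_exists_prefix_le h0 h1 R _).trans ?_
    have hβ0 : 0 ≤ p / (1 - p) := by positivity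
    calc (p / (1 - p)) ^ (candidateState x y).2 ≤ 1 * σ ^ (candidateState x y).2 := by
          rw [one_mul]; gcongr
      _ ≤ Φ (candidateState x y) := by
          simp only [Φ]
          have := one_le_pow₀ hγ (n := (candidateState x y).1)
          gcongr
  have hsub : 1 - catalanProb p L n R = coinExp p L fun x => coinExp p n fun y =>
      1 - coinProb p R fun z => HasCatalan x y z := by
    have hneg : ∀ (m : ℕ) (f : List Bool → ℝ),
        coinExp p m (fun l => 1 - f l) = 1 - coinExp p m f := by
      intro m f
      have := coinExp_add p m (fun l => 1 - f l) f
      simp only [sub_add_cancel, coinExp_const] at this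
      linarith
    simp only [hneg, catalanProb]
  rw [hsub]
  refine (coinExp_mono h0 h1.le fun x _ =>
    (coinExp_mono h0 h1.le fun y _ => hz x y).trans (iter x n)).trans ?_
  rw [coinExp_const_mul, mul_comm]
  have := coinExp_pow_deficit_le h0 h1 hγ hγβ L
  exact mul_le_mul_of_nonneg_right this (pow_nonneg (by linarith) n)

/-- Here `σ` exceeds the ruin probability `(1 - ε) / (1 + ε)` by the factor `1 + ε / 2`. This makes
the weight with a candidate contract by a factor `1 - Ω(ε ^ 2)`, which leaves room for
`γ = 1 + ε ^ 2 / 8`; the rate `ε ^ 3` is that of `γ ^ d` under the drift `ε`. -/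
theorem one_sub_catalanProb_le_two_mul {ε : ℝ} (hε : ε ∈ Set.Ioo (0 : ℝ) 1) (L n R : ℕ) :
    1 - catalanProb ((1 - ε) / 2) L n R ≤ 2 * (1 - ε ^ 3 / 16) ^ n := by
  obtain ⟨h0, h1⟩ := hε
  have hq : 1 - (1 - ε) / 2 = (1 + ε) / 2 := by ring
  have hβ : (1 - ε) / 2 / (1 - (1 - ε) / 2) = (1 - ε) / (1 + ε) := by
    rw [hq]; field_simp
  have h3 : 0 < ε ^ 3 := by positivity
  have h2 : 0 < ε ^ 2 := by positivity
  have h32 : ε ^ 3 < ε ^ 2 := by nlinarith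
  have h43 : ε ^ 4 < ε ^ 3 := by nlinarith
  have h54 : ε ^ 5 < ε ^ 4 := by nlinarith [pow_pos h0 4]
  have h21 : ε ^ 2 < ε := by nlinarith
  refine one_sub_catalanProb_le (γ := 1 + ε ^ 2 / 8) (σ := (1 - ε) / (1 + ε) * (1 + ε / 2))
    (by linarith) (by linarith) (by nlinarith) ?_ ?_ ?_ (by nlinarith) ?_ ?_ ?_ L n R
  · rw [hβ, mul_div_assoc', div_le_iff₀ (by linarith)]
    nlinarith
  · rw [hβ]
    have : 0 ≤ (1 - ε) / (1 + ε) := div_nonneg (by linarith) (by linarith)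
    nlinarith
  · have : 0 < (1 - ε) / (1 + ε) := div_pos (by linarith) (by linarith)
    positivity
  · rw [hq]
    have : (1 + ε) / 2 / (1 + ε ^ 2 / 8) ≤ (1 + ε) / 2 * (1 - ε ^ 2 / 8 + (ε ^ 2 / 8) ^ 2) := by
      rw [div_le_iff₀ (by positivity), mul_assoc]
      refine le_mul_of_one_le_right (by linarith) ?_
      have : 0 < ε ^ 6 := by positivity
      nlinarith
    refine (add_le_add_left this _).trans ?_
    nlinarith
  · rw [hq]
    have : (1 + ε) / 2 * ((1 - ε) / (1 + ε) * (1 + ε / 2)) = (1 - ε) / 2 * (1 + ε / 2) := by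
      field_simp
    rw [this]
    nlinarith
  · rw [hq]
    have : (1 + ε) / 2 * ((1 - ε) / (1 + ε) * (1 + ε / 2)) = (1 - ε) / 2 * (1 + ε / 2) := by
      field_simp
    rw [this]
    have e2 : (1 - ε) / 2 * (1 + ε ^ 2 / 8) / ((1 - ε) / (1 + ε) * (1 + ε / 2)) =
        (1 + ε) * (1 + ε ^ 2 / 8) / (2 + ε) := by
      have : 1 - ε ≠ 0 := by linarith
      field_simp
    rw [e2, ← le_sub_iff_add_le', div_le_iff₀ (by linarith)]
    nlinarith

/-- The factor `2` of the tail bound is removed by the union bound over disjoint windows: a short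
window inherits a proportional share of the probability, at least `1 / 2`, that a window of length
about `2 / θ`, with `θ = ε ^ 3 / 16`, contains a Catalan slot. -/
theorem one_sub_catalanProb_le_exp {ε : ℝ} (hε : ε ∈ Set.Ioo (0 : ℝ) 1) (L n R : ℕ) (hn : 0 < n) :
    1 - catalanProb ((1 - ε) / 2) L n R ≤ Real.exp (-(1 / 128 * ε ^ 3 * n)) := by
  have tail : ∀ N : ℕ, 1 - catalanProb ((1 - ε) / 2) L N R ≤ 2 * Real.exp (-(ε ^ 3 / 16 * N)) := by
    intro N
    refine (one_sub_catalanProb_le_two_mul hε L N R).trans ?_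
    have h := Real.one_sub_le_exp_neg (ε ^ 3 / 16)
    have h3 : ε ^ 3 ≤ 1 := pow_le_one₀ hε.1.le hε.2.le
    have := pow_le_pow_left₀ (by linarith) h N
    rw [← Real.exp_nat_mul] at this
    refine (mul_le_mul_of_nonneg_left this (by norm_num)).trans_eq ?_
    congr 2; ring
  have h3 : 0 < ε ^ 3 := pow_pos hε.1 3
  have hn' : (0 : ℝ) < n := by exact_mod_cast hn
  set t := ε ^ 3 / 16 * n with ht
  have ht0 : 0 < t := by positivity
  have hexp : -(1 / 128 * ε ^ 3 * n) = -(t / 8) := by rw [ht]; ring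
  rw [hexp]
  have h2 : (2 : ℝ) ≤ Real.exp 1 := by
    have := Real.add_one_le_exp (1 : ℝ)
    linarith
  rcases le_or_gt 2 t with hlarge | hsmall
  · refine (tail n).trans ?_
    rw [← ht]
    calc 2 * Real.exp (-t) ≤ Real.exp 1 * Real.exp (-t) := by gcongr
      _ = Real.exp (1 - t) := by rw [← Real.exp_add]; ring_nf
      _ ≤ Real.exp (-(t / 8)) := Real.exp_le_exp.2 (by linarith)
  · set m := ⌈2 / t⌉₊ with hm
    have hm1 : 2 / t ≤ m := Nat.le_ceil _
    have hm2 : (m : ℝ) < 2 / t + 1 := Nat.ceil_lt_add_one (by positivity)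
    have hm3 : m * t ≤ 4 := by
      have : (2 / t + 1) * t = 2 + t := by field_simp
      nlinarith
    have hm4 : 2 ≤ m * t := by rwa [div_le_iff₀ ht0] at hm1
    have hbig := tail (m * n)
    have hunion := catalanProb_mul_le (p := (1 - ε) / 2) (by linarith [hε.2]) (by linarith [hε.1])
      L n R m
    have he : ε ^ 3 / 16 * ((m * n : ℕ) : ℝ) = m * t := by rw [ht]; push_cast; ring
    rw [he] at hbig
    have hhalf : 2 * Real.exp (-(m * t)) ≤ 1 / 2 := by
      have h4 : 4 ≤ Real.exp (m * t) := by
        calc (4 : ℝ) = 2 * 2 := by norm_num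
          _ ≤ Real.exp 1 * Real.exp 1 := by gcongr
          _ = Real.exp 2 := by rw [← Real.exp_add]; norm_num
          _ ≤ _ := Real.exp_le_exp.2 hm4
      rw [Real.exp_neg, ← div_eq_mul_inv, div_le_iff₀ (Real.exp_pos _)]
      linarith
    have hcat : t / 8 ≤ catalanProb ((1 - ε) / 2) L n R := by
      have hm0 : (0 : ℝ) < m := by by_contra hneg; nlinarith
      have : (1 : ℝ) / 2 ≤ m * catalanProb ((1 - ε) / 2) L n R := by linarith
      by_contra! hlt
      have := mul_lt_mul_of_pos_left hlt hm0
      linarith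
    have := Real.one_sub_le_exp_neg (t / 8)
    linarith

/-! ### Tines in labelled trees -/

namespace LabeledTree

variable {F : LabeledTree}

theorem label_le_of_onTine {x v : F.V} (h : F.OnTine x v) : F.label x ≤ F.label v := by
  induction h with
  | refl => rfl
  | tail _ h ih => exact ih.trans (F.label_lt _ _ h).le

theorem depth_root (F : LabeledTree) : F.depth F.root = 0 := by
  have h := (F.parent_eq_none_iff F.root).2 rfl
  rw [depth]; split
  · rfl
  · simp_all

theorem depth_of_parent {u v : F.V} (h : F.parent v = some u) : F.depth v = F.depth u + 1 := by
  rw [depth]; split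
  · simp_all
  · simp_all

/-- Induction along the tine that ends at a vertex. -/
theorem tine_induction {P : F.V → Prop} (root : P F.root)
    (child : ∀ u v, F.parent v = some u → P u → P v) (v : F.V) : P v := by
  induction h : F.label v using Nat.strong_induction_on generalizing v with
  | _ n ih =>
    cases hp : F.parent v with
    | none => rw [(F.parent_eq_none_iff v).1 hp]; exact root
    | some u => exact child u v hp (ih _ (h ▸ F.label_lt u v hp) u rfl)

theorem onTine_root (v : F.V) : F.OnTine F.root v :=
  tine_induction (P := fun v => F.OnTine F.root v) .refl (fun _ _ h hu => hu.tail h) v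

theorem depth_pos {v : F.V} (h : v ≠ F.root) : 0 < F.depth v := by
  cases hp : F.parent v with
  | none => exact absurd ((F.parent_eq_none_iff v).1 hp) h
  | some u => rw [depth_of_parent hp]; omega

theorem onTine_total {x y v : F.V} (hx : F.OnTine x v) (hy : F.OnTine y v) :
    F.OnTine x y ∨ F.OnTine y x := by
  induction hx with
  | refl => exact .inr hy
  | tail hxb hbc ih =>
    rcases Relation.ReflTransGen.cases_tail hy with rfl | ⟨d, hyd, hd⟩
    · exact .inl (hxb.tail hbc)
    · obtain rfl := Option.some.inj (hbc.symm.trans hd)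
      exact ih hyd

theorem eq_of_onTine_of_label_eq {x y : F.V} (h : F.OnTine x y) (hl : F.label x = F.label y) :
    x = y := by
  rcases Relation.ReflTransGen.cases_tail h with rfl | ⟨d, hxd, hd⟩
  · rfl
  · have := label_le_of_onTine hxd
    have := F.label_lt _ _ hd
    omega

theorem onTine_of_label_le {x c v : F.V} (hx : F.OnTine x v) (hc : F.OnTine c v)
    (hl : F.label x ≤ F.label c) : F.OnTine x c := by
  rcases onTine_total hx hc with h | h
  · exact h
  · rw [eq_of_onTine_of_label_eq h (le_antisymm (label_le_of_onTine h) hl)]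
    exact .refl

/-- Tines that share a vertex with label at least `s` do not diverge prior to `s`. -/
theorem not_divergePriorTo_of_common {s : ℕ} {c u v : F.V} (hu : F.OnTine c u)
    (hv : F.OnTine c v) (hs : s ≤ F.label c) : ¬ F.DivergePriorTo s u v := by
  rintro (⟨x, y, hx, hy, hxs, hys, hne⟩ | ⟨⟨x, hx, hxs⟩, h⟩ | ⟨h, y, hy, hys⟩)
  · have hx' := onTine_of_label_le hx hu (hxs.trans_le hs)
    have hy' := onTine_of_label_le hy hv (hys.trans_le hs)
    rcases onTine_total hx' hy' with h | h
    · exact hne (eq_of_onTine_of_label_eq h (hxs.trans hys.symm))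
    · exact hne (eq_of_onTine_of_label_eq h (hys.trans hxs.symm)).symm
  · exact h ⟨x, (onTine_of_label_le hx hu (hxs.trans_le hs)).trans hv, hxs⟩
  · exact h ⟨y, (onTine_of_label_le hy hv (hys.trans_le hs)).trans hu, hys⟩

/-! ### Catalan slots settle the past -/

/-- The number of honest slots among the first `i` slots. -/
def honestCount (w : List Bool) (i : ℕ) : ℕ := (w.take i).count false

/-- The number of adversarial slots among the first `i` slots. -/
def adversarialCount (w : List Bool) (i : ℕ) : ℕ := (w.take i).count true

theorem counts_succ {w : List Bool} {i : ℕ} (hi : i < w.length) :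
    (HonestSlot w (i + 1) ∧ honestCount w (i + 1) = honestCount w i + 1 ∧
      adversarialCount w (i + 1) = adversarialCount w i) ∨
    (¬ HonestSlot w (i + 1) ∧ honestCount w (i + 1) = honestCount w i ∧
      adversarialCount w (i + 1) = adversarialCount w i + 1) := by
  have hget : w[i]? = some w[i] := List.getElem?_eq_getElem hi
  simp only [honestCount, adversarialCount, HonestSlot, List.take_add_one, hget,
    List.count_append, Option.toList_some]
  cases hb : w[i]
  · left; refine ⟨⟨i, rfl, by rw [hget, hb]⟩, by simp, by simp⟩
  · right
    refine ⟨?_, by simp, by simp⟩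
    rintro ⟨j, hj, hj'⟩
    obtain rfl : i = j := by omega
    simp [hget, hb] at hj'

theorem HonestSlot.le_length {w : List Bool} {i : ℕ} (h : HonestSlot w i) : i ≤ w.length := by
  obtain ⟨j, rfl, h⟩ := h
  exact (List.getElem?_eq_some_iff.1 h).1

theorem adversarialCount_mono (w : List Bool) {i j : ℕ} (h : i ≤ j) :
    adversarialCount w i ≤ adversarialCount w j :=
  (List.take_sublist_take_left h).count_le _

/-- Every honest slot contributes to the height of the fork. -/
theorem exists_depth_ge_of_honest {w : List Bool} (hF : F.IsFork w) {x : F.V}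
    (hx : x = F.root ∨ HonestSlot w (F.label x)) {m : ℕ} (hxm : F.label x ≤ m)
    (hm : m ≤ w.length) :
    ∃ y, (y = F.root ∨ HonestSlot w (F.label y)) ∧ F.label y ≤ m ∧
      F.depth x + honestCount w m ≤ F.depth y + honestCount w (F.label x) := by
  induction m, hxm using Nat.le_induction with
  | base => exact ⟨x, hx, le_rfl, le_rfl⟩
  | succ m hxm ih =>
    obtain ⟨y, hy, hym, hd⟩ := ih (by omega)
    rcases counts_succ (w := w) (i := m) (by omega) with ⟨hh, h₁, -⟩ | ⟨-, h₁, -⟩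
    · obtain ⟨z, hz : F.label z = m + 1, -⟩ := hF.unique_honest _ hh
      refine ⟨z, .inr (hz ▸ hh), hz.le, ?_⟩
      have : F.depth y < F.depth z := by
        rcases hy with rfl | hy
        · rw [depth_root]
          refine depth_pos fun h => ?_
          rw [h, F.label_root] at hz; omega
        · exact hF.honest_depth y z hy (hz ▸ hh) (by omega)
      omega
    · exact ⟨y, hy, by omega, by omega⟩

theorem depth_add_honestCount_le {w : List Bool} (hF : F.IsFork w) {x z : F.V}
    (hx : x = F.root ∨ HonestSlot w (F.label x)) (hz : HonestSlot w (F.label z))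
    (hxz : F.label x < F.label z) :
    F.depth x + honestCount w (F.label z) ≤ F.depth z + honestCount w (F.label x) := by
  have hle := HonestSlot.le_length hz
  obtain ⟨m, hm⟩ : ∃ m, F.label z = m + 1 := ⟨F.label z - 1, by omega⟩
  obtain ⟨y, hy, hym, hd⟩ := exists_depth_ge_of_honest hF hx (m := m) (by omega) (by omega)
  have : F.depth y < F.depth z := by
    rcases hy with rfl | hy
    · rw [depth_root]
      refine depth_pos fun h => ?_
      rw [h, F.label_root] at hm; omega
    · exact hF.honest_depth y z hy hz (by omega)
  rcases counts_succ (w := w) (i := m) (by omega) with ⟨-, h₁, -⟩ | ⟨h, -, -⟩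
  · rw [hm]; omega
  · exact absurd (hm ▸ hz) h

/-- Every tine of maximum length passes through the vertex of a Catalan slot. A tine that avoids
this vertex is too short: up to the slot it is behind by the honest majority of every interval
ending there, and later it can only grow by adversarial slots, as it can contain no honest vertex. -/
theorem exists_onTine_of_catalan {u v : List Bool} (hF : F.IsFork (u ++ false :: v))
    (hu : SuffixesNonneg u) (hv : PrefixesNonneg v) {x : F.V} (hx : F.IsLongest x) :
    ∃ c, F.OnTine c x ∧ F.label c = u.length + 1 := by
  set w := u ++ false :: v with hw
  have hlen : w.length = u.length + 1 + v.length := by simp [hw]; omega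
  have hc : HonestSlot w (u.length + 1) := ⟨u.length, rfl, by simp [hw]⟩
  have hbal : ∀ i, balance (w.take i) = honestCount w i - adversarialCount w i := fun i => rfl
  have hmid : balance (w.take (u.length + 1)) = balance u + 1 := by
    simp [hw, List.take_append, List.take_of_length_le (Nat.le_succ u.length)]
  have hleft : ∀ i ≤ u.length, balance (w.take i) ≤ balance u := by
    intro i hi
    have h := hu (u.take i) (u.drop i) (List.take_append_drop i u).symm
    have h' : balance u = balance (u.take i) + balance (u.drop i) := by
      rw [← balance_append, List.take_append_drop]
    have : w.take i = u.take i := by rw [hw, List.take_append_of_le_length hi]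
    rw [this]; omega
  have hright : ∀ i, u.length + 1 ≤ i → balance u + 1 ≤ balance (w.take i) := by
    intro i hi
    obtain ⟨j, rfl⟩ := Nat.exists_eq_add_of_le hi
    have h := hv (v.take j) (v.drop j) (List.take_append_drop j v).symm
    have : w.take (u.length + 1 + j) = u ++ false :: v.take j := by
      rw [hw, add_assoc, List.take_length_add_append, add_comm 1 j, List.take_succ_cons]
    rw [this]; simp; omega
  obtain ⟨z, hz : F.label z = u.length + 1, -⟩ := hF.unique_honest _ hc
  have hzh : HonestSlot w (F.label z) := hz ▸ hc
  rw [hbal] at hmid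
  -- As long as a tine avoids the Catalan slot, it stays behind the vertex `z` of this slot, up to
  -- the number of adversarial slots that have passed since.
  have inv : ∀ y, (¬ ∃ c, F.OnTine c y ∧ F.label c = u.length + 1) →
      F.depth y + 1 + adversarialCount w (u.length + 1) ≤
        F.depth z + adversarialCount w (F.label y) := by
    have early : ∀ y, y = F.root ∨ HonestSlot w (F.label y) → F.label y ≤ u.length →
        F.depth y + 1 + adversarialCount w (u.length + 1) ≤
          F.depth z + adversarialCount w (F.label y) := by
      intro y hy hyl
      have h₁ := depth_add_honestCount_le hF hy hzh (by omega)
      have h₂ := hleft _ hyl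
      rw [hbal] at h₂
      rw [hz] at h₁
      omega
    intro y
    induction y using tine_induction with
    | root => exact fun _ => early _ (.inl rfl) (by rw [F.label_root]; omega)
    | child a y hay ih =>
      intro hy
      have hal := F.label_lt a y hay
      have ha := ih fun ⟨c, hca, hcl⟩ => hy ⟨c, hca.tail hay, hcl⟩
      have hne : F.label y ≠ u.length + 1 := fun h => hy ⟨y, .refl, h⟩
      have hyw := hF.label_le y
      rw [depth_of_parent hay]
      obtain ⟨m, hm⟩ : ∃ m, F.label y = m + 1 := ⟨F.label y - 1, by omega⟩
      have hmono := adversarialCount_mono w (show F.label a ≤ m by omega)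
      rcases counts_succ (w := w) (i := m) (by omega) with ⟨hh, h₁, h₂⟩ | ⟨-, h₁, h₂⟩
      · rw [← hm] at hh
        rcases Nat.lt_or_ge (F.label y) (u.length + 1) with hlt | hge
        · have := early y (.inr hh) (by omega)
          rwa [depth_of_parent hay] at this
        · exfalso
          have h₃ := depth_add_honestCount_le hF (.inr hzh) hh (by omega)
          have h₄ := hright m (by omega)
          rw [hbal] at h₄
          rw [hz, depth_of_parent hay, hm] at h₃
          omega
      · rw [hm]; omega
  by_contra hcon
  have h := inv x hcon
  obtain ⟨y, -, -, hy⟩ := exists_depth_ge_of_honest hF (.inr hzh) (m := w.length)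
    (by omega) le_rfl
  have h₁ := hx y
  have h₂ := hright w.length (by omega)
  have h₃ := adversarialCount_mono w (hF.label_le x)
  rw [hbal] at h₂
  rw [hz] at hy
  omega

theorem not_hasSettlementViolation_of_catalan {u v : List Bool} {s : ℕ}
    (hF : F.IsFork (u ++ false :: v)) (hu : SuffixesNonneg u) (hv : PrefixesNonneg v)
    (hs : s ≤ u.length + 1) : ¬ F.HasSettlementViolation s := by
  rintro ⟨x, y, hx, hy, hdiv⟩
  obtain ⟨c, hcx, hc⟩ := exists_onTine_of_catalan hF hu hv hx
  obtain ⟨d, hdy, hd⟩ := exists_onTine_of_catalan hF hu hv hy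
  obtain rfl : c = d := (hF.unique_honest _ ⟨u.length, rfl, by simp⟩).unique hc hd
  exact not_divergePriorTo_of_common hcx hdy (by omega) hdiv

theorem not_hasSettlementViolation_zero (F : LabeledTree) : ¬ F.HasSettlementViolation 0 := by
  rintro ⟨x, y, -, -, hdiv⟩
  exact not_divergePriorTo_of_common (onTine_root x) (onTine_root y) (Nat.zero_le _) hdiv

end LabeledTree

/-! ### Plays of the settlement game -/

namespace LabeledTree

variable {F G : LabeledTree}

theorem IsForkPrefix.refl (F : LabeledTree) : IsForkPrefix F F :=
  ⟨id, Function.injective_id, fun _ => rfl, fun v => by simp⟩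

theorem IsEmbedding.depth_eq {φ : F.V → G.V} (h : IsEmbedding F G φ) (v : F.V) :
    G.depth (φ v) = F.depth v := by
  induction v using tine_induction with
  | root =>
    have hp := h.parent_eq F.root
    rw [(F.parent_eq_none_iff _).2 rfl, Option.map_none, G.parent_eq_none_iff] at hp
    rw [hp, depth_root, depth_root]
  | child u v huv ih =>
    have hp := h.parent_eq v
    rw [huv, Option.map_some] at hp
    rw [depth_of_parent hp, depth_of_parent huv, ih]

theorem honestSlot_snoc {w : List Bool} {b : Bool} {i : ℕ} :
    HonestSlot (w ++ [b]) i ↔ HonestSlot w i ∨ (b = false ∧ i = w.length + 1) := by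
  constructor
  · rintro ⟨j, rfl, hj⟩
    rcases Nat.lt_or_ge j w.length with h | h
    · rw [List.getElem?_append_left h] at hj
      exact .inl ⟨j, rfl, hj⟩
    · have hl := (List.getElem?_eq_some_iff.1 hj).1
      rw [List.length_append, List.length_singleton] at hl
      obtain rfl : j = w.length := by omega
      exact .inr ⟨by simpa using hj, rfl⟩
  · rintro (⟨j, rfl, hj⟩ | ⟨rfl, rfl⟩)
    · exact ⟨j, rfl, by rw [List.getElem?_append_left (List.getElem?_eq_some_iff.1 hj).1, hj]⟩
    · exact ⟨w.length, rfl, by simp⟩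

/-- An honest slot turns a fork into a fork. -/
theorem IsHonestExtension.isFork {w : List Bool} (hF : F.IsFork w)
    (h : IsHonestExtension (w.length + 1) F G) : G.IsFork (w ++ [false]) := by
  obtain ⟨φ, u, v, hφ, hu, hv, hcover, hvl, hvp⟩ := h
  have hlab : ∀ x, G.label (φ x) ≤ w.length := fun x => (hφ.label_eq x).trans_le (hF.label_le x)
  refine ⟨fun x => ?_, fun i hi => ?_, fun x y hx hy hxy => ?_⟩
  · rcases hcover x with rfl | ⟨x, rfl⟩
    · simp [hvl]
    · have := hlab x
      simp; omega
  · rcases honestSlot_snoc.1 hi with hi | ⟨-, rfl⟩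
    · have hil := hi.le_length
      obtain ⟨x, hx, hxu⟩ := hF.unique_honest i hi
      refine ⟨φ x, (hφ.label_eq x).trans hx, fun y hy => ?_⟩
      rcases hcover y with rfl | ⟨y, rfl⟩
      · have : w.length + 1 = i := hvl.symm.trans hy
        omega
      · rw [hxu y ((hφ.label_eq y).symm.trans hy)]
    · refine ⟨v, hvl, fun y hy => ?_⟩
      rcases hcover y with rfl | ⟨y, rfl⟩
      · rfl
      · have hy' : G.label (φ y) = w.length + 1 := hy
        have := hlab y
        omega
  · rcases hcover y with rfl | ⟨y, rfl⟩
    · rcases hcover x with rfl | ⟨x, rfl⟩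
      · omega
      · rw [depth_of_parent hvp, hφ.depth_eq, hφ.depth_eq]
        have := hu x
        omega
    · have hyl := hlab y
      rcases hcover x with rfl | ⟨x, rfl⟩
      · omega
      · have hxl := hlab x
        rw [hφ.depth_eq, hφ.depth_eq]
        rw [hφ.label_eq] at hx hy hxy hxl hyl
        rw [hφ.label_eq] at hxy
        refine hF.honest_depth x y ?_ ?_ hxy
        · exact (honestSlot_snoc.1 hx).resolve_right fun h => by omega
        · exact (honestSlot_snoc.1 hy).resolve_right fun h => by omega

theorem IsFork.of_honestSlot_imp {w w' : List Bool} (hF : F.IsFork w) (hlen : w.length = w'.length)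
    (h : ∀ i, HonestSlot w' i → HonestSlot w i) : F.IsFork w' :=
  ⟨fun v => hlen ▸ hF.label_le v, fun i hi => hF.unique_honest i (h i hi),
    fun u v hu hv => hF.honest_depth u v (h _ hu) (h _ hv)⟩

/-- The fork consisting of a single path with labels `0, 1, …, n`. -/
def chain (n : ℕ) : LabeledTree where
  V := Fin (n + 1)
  finite := inferInstance
  root := 0
  parent := Fin.cases none fun i => some i.castSucc
  label i := i
  parent_eq_none_iff v := by cases v using Fin.cases <;> simp
  label_root := rfl
  label_lt u v h := by
    cases v using Fin.cases with
    | zero => simp at h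
    | succ i =>
      simp only [Fin.cases_succ, Option.some.injEq] at h
      subst h; simp

theorem depth_chain {n : ℕ} (v : (chain n).V) : (chain n).depth v = (chain n).label v := by
  induction v using tine_induction with
  | root => rw [depth_root, (chain n).label_root]
  | child u v huv ih =>
    have hl : (chain n).label v = (chain n).label u + 1 := by
      revert huv
      refine Fin.cases (fun h => ?_) (fun i h => ?_) v
      · exact absurd h (by simp [chain])
      · obtain rfl : i.castSucc = u := Option.some.inj h
        rfl
    rw [depth_of_parent huv, ih, hl]

theorem isFork_chain (w : List Bool) : (chain w.length).IsFork w := by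
  refine ⟨fun v => Nat.lt_succ_iff.1 v.isLt, fun i hi => ?_, fun u v _ _ h => ?_⟩
  · exact ⟨(⟨i, Nat.lt_succ_iff.2 hi.le_length⟩ : Fin (w.length + 1)), rfl,
      fun y hy => Fin.ext hy⟩
  · rw [depth_chain, depth_chain]; exact h

theorem isEmbedding_chain (n : ℕ) : IsEmbedding (chain n) (chain (n + 1)) Fin.castSucc := by
  refine ⟨Fin.castSucc_injective _, fun v => rfl, fun v => ?_⟩
  induction v using Fin.cases with
  | zero => rfl
  | succ i => rfl

theorem isHonestExtension_chain (n : ℕ) : IsHonestExtension (n + 1) (chain n) (chain (n + 1)) := by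
  refine ⟨Fin.castSucc, Fin.last n, Fin.last (n + 1), isEmbedding_chain n, fun u => ?_, ?_, ?_,
    rfl, rfl⟩
  · rw [depth_chain]
    exact (Nat.lt_succ_iff.1 u.isLt).trans_eq (depth_chain (n := n) (Fin.last n)).symm
  · rintro ⟨x, hx⟩
    exact (Fin.castSucc_lt_last x).ne hx
  · intro x
    induction x using Fin.lastCases with
    | last => exact .inl rfl
    | cast i => exact .inr ⟨i, rfl⟩

end LabeledTree

open LabeledTree

variable {T : ℕ}

theorem length_stringPrefix (w : Fin T → Bool) {t : ℕ} (ht : t ≤ T) :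
    (stringPrefix w t).length = t := by
  simp [stringPrefix, ht]

theorem stringPrefix_succ (w : Fin T → Bool) (t : Fin T) :
    stringPrefix w (t + 1) = stringPrefix w t ++ [w t] := by
  simp [stringPrefix, List.take_add_one]

theorem honestSlot_stringPrefix_anti {w w' : Fin T → Bool} (h : w ≤ w') (t i : ℕ)
    (hi : HonestSlot (stringPrefix w' t) i) : HonestSlot (stringPrefix w t) i := by
  obtain ⟨j, rfl, hj⟩ := hi
  refine ⟨j, rfl, ?_⟩
  simp only [stringPrefix, List.getElem?_take, List.getElem?_ofFn] at hj ⊢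
  split_ifs at hj ⊢ with h₁ h₂
  · simp only [Option.some.injEq] at hj ⊢
    have := h ⟨j, h₂⟩
    rw [hj] at this
    exact le_bot_iff.1 this

namespace SettlementPlay

theorem isFork {w : Fin T → Bool} (P : SettlementPlay w) (t : Fin (T + 1)) :
    (P.A t).IsFork (stringPrefix w t) := by
  induction t using Fin.cases with
  | zero =>
    refine ⟨fun v => ?_, fun i hi => ?_, fun u v hu => ?_⟩
    · rw [P.initial v, LabeledTree.label_root]; exact Nat.zero_le _
    · obtain ⟨j, rfl, hj⟩ := hi
      simp [stringPrefix] at hj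
    · obtain ⟨j, hj, hj'⟩ := hu
      simp [stringPrefix] at hj'
  | succ t => exact (P.augment t).1

/-- More adversarial slots only help the adversary: the same forks form a play. -/
def mono {w w' : Fin T → Bool} (h : w ≤ w') (P : SettlementPlay w) : SettlementPlay w' where
  A := P.A
  F := P.F
  initial := P.initial
  honest t ht := P.honest t (le_bot_iff.1 ((h t).trans_eq ht))
  adversarial t _ := by
    have hlen : (stringPrefix w (t + 1)).length = (stringPrefix w' (t + 1)).length := by
      rw [length_stringPrefix _ t.isLt, length_stringPrefix _ t.isLt]
    have key : (P.F t).IsFork (stringPrefix w (t + 1)) ∧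
        IsForkPrefix (P.A t.castSucc) (P.F t) := by
      cases hw : w t with
      | true => exact P.adversarial t hw
      | false =>
        have hext := P.honest t hw
        refine ⟨?_, ?_⟩
        · rw [stringPrefix_succ, hw]
          refine IsHonestExtension.isFork (P.isFork t.castSucc) ?_
          rwa [length_stringPrefix _ t.isLt.le]
        · obtain ⟨φ, _, _, hφ, _⟩ := hext
          exact ⟨φ, hφ⟩
    exact ⟨key.1.of_honestSlot_imp hlen (honestSlot_stringPrefix_anti h _), key.2⟩
  augment t := by
    have hlen : (stringPrefix w (t + 1)).length = (stringPrefix w' (t + 1)).length := by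
      rw [length_stringPrefix _ t.isLt, length_stringPrefix _ t.isLt]
    exact ⟨(P.augment t).1.of_honestSlot_imp hlen (honestSlot_stringPrefix_anti h _),
      (P.augment t).2⟩

/-- The play in which every slot extends a single chain. -/
def trivial (w : Fin T → Bool) : SettlementPlay w :=
  have hfork (t : Fin T) : (chain (t + 1)).IsFork (stringPrefix w (t + 1)) := by
    have h := isFork_chain (stringPrefix w (t + 1))
    rwa [length_stringPrefix _ t.isLt] at h
  { A := fun t => chain t
    F := fun t => chain (t + 1)
    initial := fun v => Fin.ext (Nat.lt_one_iff.1 v.isLt)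
    honest := fun t _ => isHonestExtension_chain t
    adversarial := fun t _ => ⟨hfork t, Fin.castSucc, isEmbedding_chain t⟩
    augment := fun t => ⟨hfork t, .refl _⟩ }

theorem not_wins_zero {w : Fin T → Bool} (P : SettlementPlay w) (k : ℕ) : ¬ P.Wins 0 k := by
  rintro ⟨t, -, h⟩
  exact not_hasSettlementViolation_zero _ h

/-- A Catalan slot among the slots `s, …, s + k` settles slot `s`. -/
theorem Wins.not_hasCatalan {w : Fin T → Bool} {P : SettlementPlay w} {s k : ℕ} (h : P.Wins s k)
    {x y z : List Bool} (hw : List.ofFn w = x ++ (y ++ z)) (hx : s ≤ x.length + 1)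
    (hy : x.length + y.length ≤ s + k) : ¬ HasCatalan x y z := by
  rintro ⟨y₁, y₂, rfl, h₁, h₂⟩
  obtain ⟨t, ht, hviol⟩ := h
  have hF := P.isFork t
  obtain ⟨r, hr⟩ := Nat.exists_eq_add_of_le (hy.trans ht)
  have hpre : stringPrefix w t = (x ++ y₁) ++ false :: (y₂ ++ z.take r) := by
    rw [stringPrefix, hw, hr, add_assoc, List.take_length_add_append,
      List.take_length_add_append]
    simp
  rw [hpre] at hF
  refine not_hasSettlementViolation_of_catalan hF h₁ ?_ ?_ hviol
  · refine PrefixesNonneg.of_append (b := z.drop r) ?_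
    rwa [List.append_assoc, List.take_append_drop]
  · simp; omega

end SettlementPlay

/-- The strings on which the adversary can win. -/
def winnable (T s k : ℕ) : Set (Fin T → Bool) := {w | ∃ P : SettlementPlay w, P.Wins s k}

theorem isUpperSet_winnable (T s k : ℕ) : IsUpperSet (winnable T s k) :=
  fun _ _ h ⟨P, hP⟩ => ⟨P.mono h, hP⟩

/-- The adversary who plays optimally on every string attains the insecurity. -/
theorem settlementInsecurity_eq (D : MeasureTheory.Measure (Fin T → Bool)) (s k : ℕ) :
    settlementInsecurity D s k = D (winnable T s k) := by
  classical
  refine le_antisymm (iSup_le fun 𝒜 => MeasureTheory.measure_mono fun w hw => ⟨𝒜 w, hw⟩) ?_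
  refine le_iSup_of_le (fun w => if h : ∃ P : SettlementPlay w, P.Wins s k then h.choose
    else SettlementPlay.trivial w) (MeasureTheory.measure_mono fun w hw => ?_)
  have hw' : ∃ P : SettlementPlay w, P.Wins s k := hw
  change SettlementPlay.Wins (dite _ _ _) s k
  rw [dif_pos hw']
  exact hw'.choose_spec

/-! ### Distributions of characteristic strings -/

open MeasureTheory ProbabilityTheory

theorem measureReal_pi_bernoulli_succ (p : unitInterval) (n : ℕ) (E : Set (Fin (n + 1) → Bool)) :
    (Measure.pi fun _ : Fin (n + 1) => bernoulliMeasure true false p).real E =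
      (1 - (p : ℝ)) * (Measure.pi fun _ : Fin n => bernoulliMeasure true false p).real
          {w | Fin.cons false w ∈ E} +
        p * (Measure.pi fun _ : Fin n => bernoulliMeasure true false p).real
          {w | Fin.cons true w ∈ E} := by
  set μ := bernoulliMeasure true false p
  have hE : MeasurableSet E := E.toFinite.measurableSet
  have hmp := (measurePreserving_piFinSuccAbove (fun _ : Fin (n + 1) => μ) 0).symm
  have h := hmp.measureReal_preimage hE.nullMeasurableSet
  rw [← h, ← integral_indicator_one (hmp.measurable hE), integral_prod _ (by exact .of_finite)]
  have hsection : ∀ b, ∫ w, ((MeasurableEquiv.piFinSuccAbove (fun _ => Bool) 0).symm ⁻¹' E).indicator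
      (1 : Bool × (Fin n → Bool) → ℝ) (b, w) ∂(Measure.pi fun _ : Fin n => μ) =
      (Measure.pi fun _ : Fin n => μ).real {w | Fin.cons b w ∈ E} := by
    intro b
    rw [← integral_indicator_one (Set.toFinite _).measurableSet]
    refine integral_congr_ae (.of_forall fun w => ?_)
    have hw : (MeasurableEquiv.piFinSuccAbove (fun _ => Bool) 0).symm (b, w) = Fin.cons b w :=
      Fin.insertNth_zero' b w
    have hiff : (b, w) ∈ (MeasurableEquiv.piFinSuccAbove (fun _ => Bool) 0).symm ⁻¹' E ↔
        w ∈ {w | Fin.cons b w ∈ E} := Iff.of_eq (congrArg (· ∈ E) hw)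
    by_cases hm : w ∈ {w | Fin.cons b w ∈ E}
    · exact (Set.indicator_of_mem (hiff.2 hm) _).trans
        (Set.indicator_of_mem hm (1 : (Fin n → Bool) → ℝ)).symm
    · exact (Set.indicator_of_notMem (mt hiff.1 hm) _).trans (Set.indicator_of_notMem hm _).symm
  rw [integral_bernoulliMeasure, hsection, hsection, smul_eq_mul, smul_eq_mul, add_comm]

/-- The law of the independent symbols, evaluated by flipping one coin after the other. -/
theorem measureReal_pi_bernoulli (p : unitInterval) (n : ℕ) (Q : List Bool → Prop) :
    (Measure.pi fun _ : Fin n => bernoulliMeasure true false p).real {w | Q (List.ofFn w)} =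
      coinProb p n Q := by
  classical
  induction n generalizing Q with
  | zero =>
    by_cases h : Q []
    · simp [coinProb, coinExp, h]
    · simp [coinProb, coinExp, h]
  | succ n ih =>
    rw [measureReal_pi_bernoulli_succ]
    simp only [Set.mem_ofPred_eq, List.ofFn_cons]
    rw [ih fun l => Q (false :: l), ih fun l => Q (true :: l)]
    rfl

/-- Stochastic domination: among the distributions whose symbols are, given the past, adversarial
with probability at most `p`, the one with independent symbols gives the largest probability to
every increasing event. The hypothesis is stated without division, so that it passes to the
restrictions of `W` to a value of the first symbol. -/
theorem measureReal_le_pi_bernoulli (p : unitInterval) (n : ℕ) (W : Measure (Fin n → Bool))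
    [IsFiniteMeasure W]
    (hW : ∀ (t : Fin n) (a : Fin n → Bool), W.real {w | (∀ i < t, w i = a i) ∧ w t = true} ≤
      p * W.real {w | ∀ i < t, w i = a i}) {E : Set (Fin n → Bool)} (hE : IsUpperSet E) :
    W.real E ≤ W.real Set.univ *
      (Measure.pi fun _ : Fin n => bernoulliMeasure true false p).real E := by
  induction n with
  | zero =>
    rcases E.eq_empty_or_nonempty with rfl | ⟨w, hw⟩
    · simp
    · have : E = Set.univ := Set.eq_univ_of_forall fun v => Subsingleton.elim w v ▸ hw
      simp [this]
  | succ n ih =>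
    have meas : ∀ (m : ℕ) (S : Set (Fin m → Bool)), MeasurableSet S :=
      fun m S => S.toFinite.measurableSet
    set V : Bool → Measure (Fin n → Bool) :=
      fun b => (W.restrict {w | w 0 = b}).map Fin.tail with hV
    have htail : Measurable (Fin.tail : (Fin (n + 1) → Bool) → Fin n → Bool) :=
      measurable_of_finite _
    have hVS : ∀ b S, (V b).real S = W.real {w | w 0 = b ∧ Fin.tail w ∈ S} := by
      intro b S
      rw [hV, map_measureReal_apply htail (meas _ _), measureReal_restrict_apply (htail (meas _ _))]
      congr 1; ext w; simp [and_comm]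
    have hVfin : ∀ b, IsFiniteMeasure (V b) := fun b => by rw [hV]; infer_instance
    have hsplit : ∀ S : Set (Fin (n + 1) → Bool), W.real S =
        (V false).real {w | Fin.cons false w ∈ S} + (V true).real {w | Fin.cons true w ∈ S} := by
      intro S
      rw [hVS, hVS, ← measureReal_union _ (meas _ _)]
      · congr 1; ext w
        have hw : Fin.cons (w 0) (Fin.tail w) = w := Fin.cons_self_tail w
        cases h0 : w 0 <;> rw [h0] at hw <;> simp [h0, hw]
      · rw [Set.disjoint_left]
        rintro w ⟨h, -⟩ ⟨h', -⟩
        simp [h] at h'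
    have hVW : ∀ b, (V b).real {w | Fin.cons b w ∈ E} ≤ (V b).real Set.univ *
        (Measure.pi fun _ : Fin n => bernoulliMeasure true false p).real
          {w | Fin.cons b w ∈ E} := by
      intro b
      have := hVfin b
      refine ih (V b) (fun t a => ?_) fun u v huv hu => hE ?_ hu
      · rw [hVS, hVS]
        convert hW t.succ (Fin.cons b a) using 3
        · simp [Fin.forall_fin_succ, Fin.tail, and_assoc]
        · simp [Fin.forall_fin_succ, Fin.tail]
      · rw [Fin.cons_le_cons]
        exact ⟨le_rfl, huv⟩
    have htrue : (V true).real Set.univ ≤ p * W.real Set.univ := by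
      have := hW 0 fun _ => true
      rw [hVS]
      simpa using this
    have hmass := hsplit Set.univ
    simp only [Set.mem_univ, Set.ofPred_true] at hmass
    have hle : (Measure.pi fun _ : Fin n => bernoulliMeasure true false p).real
        {w | Fin.cons false w ∈ E} ≤
        (Measure.pi fun _ : Fin n => bernoulliMeasure true false p).real
        {w | Fin.cons true w ∈ E} := by
      refine measureReal_mono fun w hw => hE ?_ hw
      rw [Fin.cons_le_cons]
      exact ⟨by decide, le_rfl⟩
    rw [hsplit E, measureReal_pi_bernoulli_succ]
    have h₁ := hVW false
    have h₂ := hVW true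
    have h₃ := mul_le_mul_of_nonneg_right htrue (sub_nonneg.2 hle)
    rw [hmass] at h₃ ⊢
    linarith

instance isProbabilityMeasure_iidBernoulli (ε : ℝ) (hε : ε ∈ Set.Ioo (0 : ℝ) 1) (T : ℕ) :
    IsProbabilityMeasure (iidBernoulli ε hε T) := by
  unfold iidBernoulli; infer_instance

/-- With independent symbols, the adversary wins at most as often as the window of slots
`s, …, s + k` contains no Catalan slot. -/
theorem measureReal_winnable_le {ε : ℝ} (hε : ε ∈ Set.Ioo (0 : ℝ) 1) (s k T : ℕ) :
    (iidBernoulli ε hε T).real (winnable T s k) ≤ Real.exp (-(1 / 128 * ε ^ 3 * k)) := by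
  rcases Set.eq_empty_or_nonempty (winnable T s k) with hempty | ⟨w₀, P₀, hP₀⟩
  · rw [hempty, measureReal_empty]; positivity
  obtain ⟨t, ht, -⟩ := id hP₀
  have hs : s ≠ 0 := by rintro rfl; exact P₀.not_wins_zero k hP₀
  obtain ⟨L, rfl⟩ := Nat.exists_eq_succ_of_ne_zero hs
  obtain ⟨R, rfl⟩ : ∃ R, T = L + (k + 1 + R) := ⟨T - (L + (k + 1)), by have := t.is_le; omega⟩
  set Q : List Bool → Prop := fun l =>
    HasCatalan (l.take L) ((l.drop L).take (k + 1)) ((l.drop L).drop (k + 1))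
  have hsub : winnable (L + (k + 1 + R)) (L + 1) k ⊆ {w | ¬ Q (List.ofFn w)} := by
    rintro w ⟨P, hP⟩
    refine hP.not_hasCatalan ?_ ?_ ?_
    · rw [List.take_append_drop, List.take_append_drop]
    · simp
    · simp; omega
  have hprob : coinProb ((1 - ε) / 2) (L + (k + 1 + R)) Q =
      catalanProb ((1 - ε) / 2) L (k + 1) R := by
    rw [coinProb, coinExp_append]
    refine coinExp_congr fun x hx => ?_
    rw [coinExp_append]
    refine coinExp_congr fun y hy => coinExp_congr fun z _ => ?_
    have hxyz : Q (x ++ (y ++ z)) = HasCatalan x y z := by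
      change HasCatalan _ _ _ = _
      rw [List.take_left' hx, List.drop_left' hx, List.take_left' hy, List.drop_left' hy]
    exact congrArg (fun P : Prop => @ite ℝ P (Classical.propDecidable P) 1 0) hxyz
  refine (measureReal_mono hsub).trans ?_
  refine (measureReal_pi_bernoulli _ _ fun l => ¬ Q l).trans_le ?_
  rw [coinProb_not, hprob]
  refine (one_sub_catalanProb_le_exp hε L (k + 1) R (Nat.succ_pos k)).trans ?_
  have : 0 < ε ^ 3 := pow_pos hε.1 3
  refine Real.exp_le_exp.2 ?_
  push_cast
  linarith

theorem theorem1 :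
    ∃ c : ℝ, 0 < c ∧
      ∀ (ε : ℝ) (hε : ε ∈ Set.Ioo (0 : ℝ) 1) (s k T : ℕ)
        (W : MeasureTheory.Measure (Fin T → Bool)) [MeasureTheory.IsProbabilityMeasure W],
        EpsMartingale ε W →
          settlementInsecurity W s k ≤ settlementInsecurity (iidBernoulli ε hε T) s k ∧
          settlementInsecurity (iidBernoulli ε hε T) s k ≤
            ENNReal.ofReal (Real.exp (-(c * ε ^ 3 * (k : ℝ)))) := by
  refine ⟨1 / 128, by norm_num, fun ε hε s k T W _ hW => ?_⟩
  rw [settlementInsecurity_eq, settlementInsecurity_eq]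
  constructor
  · rw [← ENNReal.toReal_le_toReal (measure_ne_top _ _) (measure_ne_top _ _)]
    have h := measureReal_le_pi_bernoulli
      ⟨(1 - ε) / 2, by constructor <;> linarith [hε.1, hε.2]⟩ T W (fun t a => ?_)
      (isUpperSet_winnable T s k)
    · rwa [probReal_univ, one_mul] at h
    · set A : Set (Fin T → Bool) := {w | ∀ i < t, w i = a i}
      have hA : MeasurableSet A := A.toFinite.measurableSet
      have hp : 0 ≤ (1 - ε) / 2 := by linarith [hε.2]
      have hcond := ENNReal.toReal_mono ENNReal.ofReal_ne_top (hW t a)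
      rw [ENNReal.toReal_ofReal hp] at hcond
      have hmul := cond_mul_eq_inter hA {w | w t = true} W
      have hmul' := congrArg ENNReal.toReal hmul
      rw [ENNReal.toReal_mul] at hmul'
      change W.real (A ∩ {w | w t = true}) ≤ _
      rw [Measure.real, ← hmul']
      exact mul_le_mul_of_nonneg_right hcond ENNReal.toReal_nonneg
  · rw [← ENNReal.ofReal_toReal (measure_ne_top _ (winnable T s k))]
    exact ENNReal.ofReal_le_ofReal (measureReal_winnable_le hε s k T)
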